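/- Let $E$ be a finite (non-empty, discrete) set, $(G,\mathcal G)$ a measurable space, $f:E\times G\to E$ a measurable map, $\beta$ a probability measure on $G$, and write $f_v=f(\cdot,v):E\to E$. On a probability space let $V=(V_n)_{n\in\mathbf Z}$ be independent $G$-valued random variables of law $\beta$, and let $X=(X_n)_{n\in\mathbf Z}$ be $E$-valued random variables such that, for every $n\in\mathbf Z$, $X_{n+1}=f(X_n,V_{n+1})$ almost surely and $V_{n+1}$ is independent of $((X_k,V_k))_{k\le n}$. Let $\Pi(x,\cdot)$ be the law of $f(x,V_1)$ and assume that the transition kernel $\Pi$ is irreducible and aperiodic. Call two states $x,y\in E$ accordable if, for the kernel $\Pi_2$ on $E^2$ for which $\Pi_2((x,y),\cdot)$ is the law of $(f(x,V_1),f(y,V_1))$, the diagonal of $E^2$ is accessible from $(x,y)$, i.e. if there is $l\ge 1$ with $P[f_{V_l}\circ\cdots\circ f_{V_1}(x)=f_{V_l}\circ\cdots\circ f_{V_1}(y)]>0$. Let $M$ be the maximal number of pairwise non-accordable states of $E$. For $n\in\mathbf N$ put $T_n=f_{V_0}\circ f_{V_{-1}}\circ\cdots\circ f_{V_{-n+1}}$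 (with $T_0=\mathrm{id}_E$), and let $R_0=\bigcap_{n\in\mathbf N}T_n(E)$. Then, almost surely, the conditional law of $X_0$ given $V$ is the uniform law on $R_0$. Moreover, almost surely, $R_0$ consists of exactly $M$ states, and these are pairwise non-accordable. -/

import Mathlib

open MeasureTheory ProbabilityTheory

noncomputable section

namespace ConstructiveChain

variable {E G Ω : Type*}

/-- `X` is a constructive Markov chain indexed by `ℤ`, governed by `f` and by the i.i.d.
innovations `V` with common law `β`. -/
structure IsGoverned [MeasurableSpace E] [MeasurableSpace G] [MeasurableSpace Ω]
    (P : Measure Ω) (f : E → G → E) (β : Measure G) (X : ℤ → Ω → E) (V : ℤ → Ω → G) : Prop where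
  measurable_X : ∀ n, Measurable (X n)
  measurable_V : ∀ n, Measurable (V n)
  /-- The innovations are independent ... -/
  indep : iIndepFun V P
  /-- ... with common law `β`. -/
  law : ∀ n, P.map (V n) = β
  /-- `V_{n+1}` is independent of the past `((X_k, V_k))_{k ≤ n}`. -/
  indep_past : ∀ n : ℤ,
    IndepFun (V (n + 1)) (fun ω (k : Set.Iic n) => (X k ω, V k ω)) P
  /-- The recursion `X_{n+1} = f(X_n, V_{n+1})`. -/
  recursion : ∀ n : ℤ, ∀ᵐ ω ∂P, X (n + 1) ω = f (X n ω) (V (n + 1) ω)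

/-- The transition kernel `Π`: `Π(x, ·)` is the law of `f(x, v)` when `v` has law `β`. -/
def transitionKernel [Finite E] [MeasurableSpace E] [DiscreteMeasurableSpace E]
    [MeasurableSpace G] (f : E → G → E) (β : Measure G) : Kernel E E where
  toFun x := β.map (fun v => f x v)
  measurable' := Measurable.of_discrete

/-- The two-point kernel `Π₂`: `Π₂((x, y), ·)` is the law of `(f(x, v), f(y, v))` when `v` has
law `β`. -/
def pairKernel [Finite E] [MeasurableSpace E] [DiscreteMeasurableSpace E]
    [MeasurableSpace G] (f : E → G → E) (β : Measure G) : Kernel (E × E) (E × E) where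
  toFun p := β.map (fun v => (f p.1 v, f p.2 v))
  measurable' := Measurable.of_discrete

/-- Aperiodicity: for every state `x`, the only common divisor of the possible return times to
`x` is `1`. -/
def Aperiodic [MeasurableSpace E] (κ : Kernel E E) : Prop :=
  ∀ x : E, ∀ d : ℕ, (∀ n : ℕ, 1 ≤ n → 0 < (κ ^ n) x {x} → d ∣ n) → d = 1

/-- Two states `x`, `y` are accordable if the diagonal is accessible from `(x, y)` for the
two-point kernel. -/
def Accordable [Finite E] [MeasurableSpace E] [DiscreteMeasurableSpace E]
    [MeasurableSpace G] (f : E → G → E) (β : Measure G) (x y : E) : Prop :=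
  ∃ l : ℕ, 1 ≤ l ∧ 0 < (pairKernel f β ^ l) (x, y) (Set.diagonal E)

/-- The states in `s` are pairwise non-accordable. -/
def PairwiseNonAccordable [Finite E] [MeasurableSpace E] [DiscreteMeasurableSpace E]
    [MeasurableSpace G] (f : E → G → E) (β : Measure G) (s : Set E) : Prop :=
  s.Pairwise fun x y => ¬ Accordable f β x y

/-- The maximal number `M` of pairwise non-accordable states (a maximum, since `E` is finite and
the empty set qualifies). -/
def maxNonAccordable [Finite E] [MeasurableSpace E] [DiscreteMeasurableSpace E]
    [MeasurableSpace G] (f : E → G → E) (β : Measure G) : ℕ :=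
  sSup {k : ℕ | ∃ s : Set E, PairwiseNonAccordable f β s ∧ s.ncard = k}

/-- `T_n = f_{v_0} ∘ f_{v_{-1}} ∘ ⋯ ∘ f_{v_{-n+1}}`, where `f_v = f(·, v)`, and `T_0 = id`. -/
def T (f : E → G → E) (v : ℤ → G) : ℕ → E → E
  | 0 => id
  | n + 1 => T f v n ∘ fun x => f x (v (-(n : ℤ)))

/-- `R_0 = ⋂_n T_n(E)`. -/
def R₀ (f : E → G → E) (v : ℤ → G) : Set E :=
  ⋂ n : ℕ, Set.range (T f v n)

end ConstructiveChain

end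

open MeasureTheory ProbabilityTheory

noncomputable section

namespace ConstructiveChain

variable {E G Ω : Type*}

/-! Let H be the finite monoid generated by the self-maps that `f_v` equals with positive
probability. If g has minimal rank in H, every h in H is injective on the range of g
(`IsMinimalRank.injOn_range`): its points are pairwise non-accordable. Conversely, a suitable
product in H is injective on any pairwise non-accordable set, so the minimal rank is M
(`rank_eq_maxNonAccordable`).

Almost surely `T_n` reaches minimal rank, since independent blocks keep giving it a chance to do so
(`IsGoverned.ae_exists_isMinimalRank`). The decreasing ranges are constant from then on, and `R₀` is
their common value.

Uniformity rests on a maximum principle. A chain over ℤ with primitive kernel is stationary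
(`law_succ_eq_of_pow_pos`). For its law μ, the weight of a fiber is the average of the weights of
its preimages under `f_v`, so a heaviest fiber has only heaviest preimages. Every fiber of a
minimal-rank map over a point of its range is such a preimage, so all of these weigh 1/M
(`measure_fiber_of_isMinimalRank`).

Finally `X_0 = T_n(X_{-n})`, with `X_{-n}` of law μ and independent of the innovations after time
-n. Given these, `X_0` has law the image of μ under `T_n`, which for large n is uniform on `R₀`. -/

instance instMeasurableSpaceEnd : MeasurableSpace (Function.End E) := ⊤

instance instDiscreteMeasurableSpaceEnd : DiscreteMeasurableSpace (Function.End E) :=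
  ⟨fun _ => trivial⟩

instance instFiniteEnd [Finite E] : Finite (Function.End E) :=
  inferInstanceAs (Finite (E → E))

/-- The random map `f_v = f(·, v)`, as an element of the monoid of self-maps of `E`. -/
def step (f : E → G → E) (v : G) : Function.End E := fun x => f x v

/-- The self-maps of `E` that `f_v` equals with positive probability when `v` has law `β`. -/
def stepSupport [MeasurableSpace G] (f : E → G → E) (β : Measure G) : Set (Function.End E) :=
  {g | β {v | step f v = g} ≠ 0}

/-- The number of values of a self-map. -/
def rank (g : Function.End E) : ℕ := (Set.range g).ncard

/-- `g` has the least number of values among the elements of `H`. -/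
def IsMinimalRank (H : Submonoid (Function.End E)) (g : Function.End E) : Prop :=
  g ∈ H ∧ ∀ h ∈ H, rank g ≤ rank h

/-! ### Minimal rank in a finite monoid of self-maps -/

section Rank

lemma range_mul (g h : Function.End E) : Set.range (g * h) = g '' Set.range h :=
  Set.range_comp g h

lemma IsMinimalRank.rank_eq {H : Submonoid (Function.End E)}
    {g h : Function.End E} (hg : IsMinimalRank H g) (hh : IsMinimalRank H h) :
    rank g = rank h :=
  le_antisymm (hg.2 h hh.1) (hh.2 g hg.1)

variable [Finite E]

lemma rank_mul_le_left (g h : Function.End E) : rank (g * h) ≤ rank g := by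
  unfold rank
  rw [range_mul]
  exact Set.ncard_le_ncard (Set.image_subset_range _ _)

lemma rank_mul_le_right (g h : Function.End E) : rank (g * h) ≤ rank h := by
  unfold rank
  rw [range_mul]
  exact Set.ncard_image_le

variable {H : Submonoid (Function.End E)} {g h : Function.End E}

lemma exists_isMinimalRank (H : Submonoid (Function.End E)) : ∃ g, IsMinimalRank H g := by
  obtain ⟨g, hg⟩ := Finite.exists_min (fun g : H => rank (g : Function.End E))
  exact ⟨g, g.2, fun h hh => hg ⟨h, hh⟩⟩

lemma IsMinimalRank.mul_left (hg : IsMinimalRank H g) (hh : h ∈ H) : IsMinimalRank H (h * g) :=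
  ⟨H.mul_mem hh hg.1, fun k hk => (rank_mul_le_right h g).trans (hg.2 k hk)⟩

/-- The map h * g again has minimal rank, so h cannot merge points of the range of g. -/
lemma IsMinimalRank.injOn_range (hg : IsMinimalRank H g) (hh : h ∈ H) :
    Set.InjOn h (Set.range g) := by
  have := (hg.mul_left hh).rank_eq hg
  unfold rank at this
  rw [range_mul] at this
  exact Set.injOn_of_ncard_image_eq this

end Rank

/-! ### Weights of fibers under a stationary law -/

section FiberWeight

variable [MeasurableSpace G]

/-- The maps in the support are atoms of the law of `f_v`, so no null set of v can swallow one. -/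
lemma exists_step_eq_of_ae {f : E → G → E} {β : Measure G} {p : G → Prop} (hp : ∀ᵐ v ∂β, p v)
    {g : Function.End E} (hg : g ∈ stepSupport f β) : ∃ v, step f v = g ∧ p v := by
  by_contra! h
  exact hg (measure_mono_null (fun v hv => h v hv) (ae_iff.1 hp))

variable [Finite E]

lemma ae_step_mem_stepSupport (f : E → G → E) (β : Measure G) :
    ∀ᵐ v ∂β, step f v ∈ stepSupport f β := by
  have h : ∀ g : Function.End E, ∀ᵐ v ∂β, step f v = g → g ∈ stepSupport f β := by
    intro g
    by_cases hg : β {v | step f v = g} = 0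
    · filter_upwards [measure_eq_zero_iff_ae_notMem.1 hg] with v hv h
      exact absurd h hv
    · exact Filter.Eventually.of_forall fun _ _ => hg
  filter_upwards [ae_all_iff.2 h] with v hv using hv _ rfl

lemma stepSupport_nonempty {f : E → G → E} {β : Measure G}
    [IsProbabilityMeasure β] : (stepSupport f β).Nonempty := by
  obtain ⟨v, hv⟩ := (ae_step_mem_stepSupport f β).exists
  exact ⟨_, hv⟩

variable [MeasurableSpace E] [DiscreteMeasurableSpace E]

lemma measurable_step {f : E → G → E} (hf : Measurable (Function.uncurry f)) :
    Measurable (step f) := by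
  refine measurable_to_countable' fun g => ?_
  have : step f ⁻¹' {g} = ⋂ x, {v | f x v = g x} := by
    ext v
    simp only [Set.mem_preimage, Set.mem_singleton_iff, Set.mem_iInter, Set.mem_ofPred_eq]
    exact funext_iff
  rw [this]
  refine MeasurableSet.iInter fun x => ?_
  exact (hf.comp measurable_prodMk_left) (measurableSet_singleton (g x))

/-- If the weight of a fiber is maximal among all fibers of elements of the generated monoid,
so is the weight of its preimages, the weight being stationary. -/
lemma measure_fiber_mul_eq_of_maximal {f : E → G → E} (hf : Measurable (Function.uncurry f))
    {β : Measure G} [IsProbabilityMeasure β] {μ : Measure E} [IsProbabilityMeasure μ]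
    (hstat : ∀ A : Set E, ∫⁻ v, μ (step f v ⁻¹' A) ∂β = μ A) {c : ENNReal}
    (hc : ∀ h ∈ Submonoid.closure (stepSupport f β), ∀ x, μ (h ⁻¹' {x}) ≤ c)
    {g : Function.End E} (hg : g ∈ Submonoid.closure (stepSupport f β)) :
    ∀ h ∈ Submonoid.closure (stepSupport f β), ∀ x, μ (h ⁻¹' {x}) = c →
      μ ((h * g) ⁻¹' {x}) = c := by
  induction hg using Submonoid.closure_induction with
  | one => intro h _ x hx; simpa using hx
  | mul a b ha hb iha ihb =>
    intro h hh x hx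
    rw [← mul_assoc]
    exact ihb _ (Submonoid.mul_mem _ hh ha) x (iha h hh x hx)
  | mem g hg =>
    intro h hh x hx
    have hle : ∀ᵐ v ∂β, μ (step f v ⁻¹' (h ⁻¹' {x})) ≤ c := by
      filter_upwards [ae_step_mem_stepSupport f β] with v hv
      exact hc (h * step f v) (Submonoid.mul_mem _ hh (Submonoid.subset_closure hv)) x
    have hmeas : Measurable fun v => μ (step f v ⁻¹' (h ⁻¹' {x})) :=
      (Measurable.of_discrete (f := fun k : Function.End E => μ (k ⁻¹' (h ⁻¹' {x})))).comp
        (measurable_step hf)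
    have hfin : ∫⁻ v, μ (step f v ⁻¹' (h ⁻¹' {x})) ∂β ≠ ⊤ := by
      rw [hstat]; exact measure_ne_top _ _
    -- The average over v equals the upper bound c, so almost every term does; each atom inherits
    -- the equality.
    have heq := ae_eq_of_ae_le_of_lintegral_le hle hfin measurable_const.aemeasurable
      (by rw [hstat, hx]; simp)
    obtain ⟨v, hv, hv'⟩ := exists_step_eq_of_ae heq hg
    rw [← hv]
    exact hv'

/-- All fibers of a map of minimal rank have the same weight for a stationary law. -/
theorem measure_fiber_of_isMinimalRank [Nonempty E] {f : E → G → E}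
    (hf : Measurable (Function.uncurry f))
    {β : Measure G} [IsProbabilityMeasure β] {μ : Measure E} [IsProbabilityMeasure μ]
    (hstat : ∀ A : Set E, ∫⁻ v, μ (step f v ⁻¹' A) ∂β = μ A)
    (htrans : ∀ x y, ∃ k ∈ Submonoid.closure (stepSupport f β), k x = y)
    {g : Function.End E} (hg : IsMinimalRank (Submonoid.closure (stepSupport f β)) g)
    {y : E} (hy : y ∈ Set.range g) : μ (g ⁻¹' {y}) = (rank g : ENNReal)⁻¹ := by
  set H := Submonoid.closure (stepSupport f β)
  obtain ⟨⟨h₀, x₀⟩, hmax⟩ :=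
    Finite.exists_max (fun p : H × E => μ ((p.1 : Function.End E) ⁻¹' {p.2}))
  set c := μ ((h₀ : Function.End E) ⁻¹' {x₀}) with hc
  have hle : ∀ h ∈ H, ∀ x, μ (h ⁻¹' {x}) ≤ c := fun h hh x => hmax (⟨h, hh⟩, x)
  have hc0 : c ≠ 0 := by
    intro h0
    have : μ (Set.univ) = 0 := by
      rw [← Set.iUnion_of_singleton E, measure_iUnion_null_iff]
      intro x
      exact le_antisymm ((hle 1 H.one_mem x).trans h0.le) zero_le
    simp at this
  have hfib : ∀ z ∈ Set.range g, μ (g ⁻¹' {z}) = c := by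
    intro z hz
    -- Transport z by some k into the heaviest fiber, that of `h₀` over `x₀`. As `h₀ * k` is
    -- injective on the range of g, the fiber of `h₀ * k * g` over `x₀` is exactly that of g over z.
    obtain ⟨a, ha⟩ := nonempty_of_measure_ne_zero hc0
    obtain ⟨k, hk, hka⟩ := htrans z a
    have h1 : μ ((h₀ * (k * g) : Function.End E) ⁻¹' {x₀}) = c :=
      measure_fiber_mul_eq_of_maximal hf hstat hle (H.mul_mem hk hg.1) h₀ h₀.2 x₀ rfl
    have hinj : Set.InjOn (h₀ * k : Function.End E) (Set.range g) :=
      hg.injOn_range (H.mul_mem h₀.2 hk)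
    have hz' : (h₀ * k : Function.End E) z = x₀ := by
      change (h₀ : Function.End E) (k z) = x₀
      rw [hka]; exact ha
    rw [← h1]
    congr 1
    ext w
    constructor
    · intro hw
      change (h₀ * k : Function.End E) (g w) = x₀
      rw [show g w = z from hw, hz']
    · intro hw
      exact hinj ⟨w, rfl⟩ hz (hz'.symm ▸ hw)
  have hsum : (rank g : ENNReal) * c = 1 := by
    have hfin := Set.toFinite (Set.range g)
    have := sum_measure_preimage_singleton (μ := μ) (f := g) hfin.toFinset
      (fun _ _ => MeasurableSet.of_discrete)
    rw [Finset.sum_congr rfl (fun z hz => hfib z (hfin.mem_toFinset.1 hz))] at this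
    have hpre : g ⁻¹' (hfin.toFinset : Set E) = Set.univ := by
      rw [hfin.coe_toFinset]
      exact Set.preimage_range (f := (g : E → E))
    rw [hpre, measure_univ, Finset.sum_const] at this
    simpa [rank, Set.ncard_eq_toFinset_card _ hfin] using this
  rw [hfib y hy]
  exact ENNReal.eq_inv_of_mul_eq_one_left (by rwa [mul_comm])

end FiberWeight

/-! ### Accessibility in terms of products of maps -/

section KernelPowers

variable {Z : Type*} [MeasurableSpace Z] [DiscreteMeasurableSpace Z]
  [MulAction (Function.End E) Z]

open scoped Pointwise

/-- Stated for an arbitrary action so as to serve both Π on E and Π₂ on pairs, where maps act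
diagonally. -/
lemma kernel_pow_pos_iff {κ : Kernel Z Z} {S : Set (Function.End E)}
    (hκ : ∀ z A, 0 < κ z A ↔ ∃ g ∈ S, g • z ∈ A) (n : ℕ) (z : Z) (A : Set Z) :
    0 < (κ ^ n) z A ↔ ∃ g ∈ S ^ n, g • z ∈ A := by
  induction n generalizing A with
  | zero =>
    have : (κ ^ 0) z A = A.indicator 1 z := by
      rw [pow_zero]
      exact Measure.dirac_apply' _ MeasurableSet.of_discrete
    rw [this]
    by_cases hz : z ∈ A <;> simp [hz]
  | succ n ih =>
    rw [Kernel.pow_succ_apply_eq_lintegral _ _ _ MeasurableSet.of_discrete,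
      lintegral_pos_iff_support Measurable.of_discrete, ih]
    constructor
    · rintro ⟨g, hg, hgz⟩
      obtain ⟨h, hh, hhA⟩ := (hκ _ _).1 (pos_iff_ne_zero.2 hgz)
      refine ⟨h * g, ?_, by rwa [mul_smul]⟩
      rw [pow_succ']
      exact Set.mul_mem_mul hh hg
    · rintro ⟨k, hk, hkA⟩
      rw [pow_succ'] at hk
      obtain ⟨h, hh, g, hg, rfl⟩ := Set.mem_mul.1 hk
      refine ⟨g, hg, (pos_iff_ne_zero.1 ((hκ _ _).2 ⟨h, hh, ?_⟩))⟩
      rwa [← mul_smul]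

variable [Finite E] [MeasurableSpace G] {f : E → G → E} {β : Measure G}

lemma measure_step_pos_iff (p : Function.End E → Prop) :
    0 < β {v | p (step f v)} ↔ ∃ g ∈ stepSupport f β, p g := by
  constructor
  · intro h
    by_contra! hn
    refine h.ne' (measure_eq_zero_iff_ae_notMem.2 ?_)
    filter_upwards [ae_step_mem_stepSupport f β] with v hv using hn _ hv
  · rintro ⟨g, hg, hp⟩
    exact (pos_iff_ne_zero.2 hg).trans_le (measure_mono fun v hv => by
      rw [Set.mem_ofPred_eq] at hv ⊢; rwa [hv])

variable [MeasurableSpace E] [DiscreteMeasurableSpace E]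

lemma transitionKernel_pow_pos_iff (hf : Measurable (Function.uncurry f)) (n : ℕ) (x : E)
    (A : Set E) : 0 < (transitionKernel f β ^ n) x A ↔ ∃ g ∈ stepSupport f β ^ n, g x ∈ A := by
  refine kernel_pow_pos_iff (fun z A => ?_) n x A
  have : transitionKernel f β z A = β {v | (step f v) • z ∈ A} :=
    Measure.map_apply (hf.comp measurable_prodMk_left) MeasurableSet.of_discrete
  rw [this]
  exact measure_step_pos_iff (fun g => g • z ∈ A)

lemma pairKernel_pow_pos_iff (hf : Measurable (Function.uncurry f)) (n : ℕ) (z : E × E)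
    (A : Set (E × E)) :
    0 < (pairKernel f β ^ n) z A ↔ ∃ g ∈ stepSupport f β ^ n, (g z.1, g z.2) ∈ A := by
  refine kernel_pow_pos_iff (fun z A => ?_) n z A
  have : pairKernel f β z A = β {v | (step f v) • z ∈ A} :=
    Measure.map_apply ((hf.comp measurable_prodMk_left).prodMk (hf.comp measurable_prodMk_left))
      MeasurableSet.of_discrete
  rw [this]
  exact measure_step_pos_iff (fun g => g • z ∈ A)

lemma accordable_iff (hf : Measurable (Function.uncurry f)) (x y : E) :
    Accordable f β x y ↔ ∃ l : ℕ, 1 ≤ l ∧ ∃ g ∈ stepSupport f β ^ l, g x = g y := by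
  simp only [Accordable, pairKernel_pow_pos_iff hf, Set.mem_diagonal_iff]

end KernelPowers

/-! ### Minimal rank and non-accordable states -/

section Accordable

open scoped Pointwise

variable [Finite E] [MeasurableSpace E] [DiscreteMeasurableSpace E] [MeasurableSpace G]
  {f : E → G → E} {β : Measure G}

lemma mem_closure_of_mem_pow {M : Type*} [Monoid M] {S : Set M} {n : ℕ} {g : M}
    (hg : g ∈ S ^ n) : g ∈ Submonoid.closure S := by
  induction n generalizing g with
  | zero => rw [pow_zero, Set.mem_one] at hg; exact hg ▸ Submonoid.one_mem _
  | succ n ih =>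
    rw [pow_succ] at hg
    obtain ⟨a, ha, b, hb, rfl⟩ := Set.mem_mul.1 hg
    exact Submonoid.mul_mem _ (ih ha) (Submonoid.subset_closure hb)

lemma exists_mem_pow_of_mem_closure {M : Type*} [Monoid M] {S : Set M} {g : M}
    (hg : g ∈ Submonoid.closure S) : ∃ n, g ∈ S ^ n := by
  induction hg using Submonoid.closure_induction with
  | one => exact ⟨0, by simp⟩
  | mem g hg => exact ⟨1, by simpa⟩
  | mul a b _ _ iha ihb =>
    obtain ⟨m, hm⟩ := iha
    obtain ⟨n, hn⟩ := ihb
    exact ⟨m + n, by rw [pow_add]; exact Set.mul_mem_mul hm hn⟩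

lemma pairwiseNonAccordable_range (hf : Measurable (Function.uncurry f)) {g : Function.End E}
    (hg : IsMinimalRank (Submonoid.closure (stepSupport f β)) g) :
    PairwiseNonAccordable f β (Set.range g) := by
  intro x hx y hy hxy hacc
  obtain ⟨l, -, h, hh, heq⟩ := (accordable_iff hf x y).1 hacc
  exact hxy (hg.injOn_range (mem_closure_of_mem_pow hh) hx hy heq)

lemma rank_eq_maxNonAccordable [IsProbabilityMeasure β] (hf : Measurable (Function.uncurry f))
    {g : Function.End E} (hg : IsMinimalRank (Submonoid.closure (stepSupport f β)) g) :
    rank g = maxNonAccordable f β := by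
  symm
  refine IsGreatest.csSup_eq ⟨⟨_, pairwiseNonAccordable_range hf hg, rfl⟩, ?_⟩
  rintro _ ⟨s, hs, rfl⟩
  obtain ⟨n, hn⟩ := exists_mem_pow_of_mem_closure hg.1
  -- The extra factor a secures length at least 1, as accordability requires; g itself may be the
  -- empty product.
  obtain ⟨a, ha⟩ := stepSupport_nonempty (f := f) (β := β)
  have hmem : a * g ∈ stepSupport f β ^ (n + 1) := by
    rw [pow_succ']; exact Set.mul_mem_mul ha hn
  have hinj : Set.InjOn (a * g : Function.End E) s := by
    intro x hx y hy hxy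
    by_contra hne
    exact hs hx hy hne ((accordable_iff hf x y).2 ⟨n + 1, by omega, _, hmem, hxy⟩)
  calc s.ncard = ((a * g : Function.End E) '' s).ncard := hinj.ncard_image.symm
    _ ≤ rank (a * g) := Set.ncard_le_ncard (Set.image_subset_range _ _)
    _ ≤ rank g := rank_mul_le_right a g

end Accordable

/-! ### Primitivity and stationarity -/

section Stationarity

/-- A bounded backward orbit, with total mass zero, of a stochastic matrix with positive entries
vanishes. -/
lemma eq_zero_of_backward_orbit [Fintype E] [Nonempty E] {A : E → E → ℝ} {ε C : ℝ} (hε : 0 < ε)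
    (hA : ∀ x y, ε ≤ A x y) (hrow : ∀ x, ∑ y, A x y = 1) {d : ℕ → E → ℝ}
    (hrec : ∀ k y, d k y = ∑ x, d (k + 1) x * A x y) (hsum : ∀ k, ∑ x, d k x = 0)
    (hbd : ∀ k, ∑ x, |d k x| ≤ C) (x : E) : d 0 x = 0 := by
  set r : ℝ := 1 - Fintype.card E * ε with hr
  have hrow' : ∀ x, ∑ y, (A x y - ε) = r := by
    intro x
    rw [Finset.sum_sub_distrib, hrow]
    simp [hr]
  have hr0 : 0 ≤ r := by
    obtain ⟨x⟩ := ‹Nonempty E›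
    rw [← hrow' x]
    exact Finset.sum_nonneg fun y _ => sub_nonneg.2 (hA x y)
  have hr1 : r < 1 := by
    have : (0 : ℝ) < Fintype.card E * ε := mul_pos (by exact_mod_cast Fintype.card_pos) hε
    linarith
  -- As d has total mass zero, subtracting ε from every entry of A leaves the recursion unchanged,
  -- while the row sums drop to r < 1: a contraction in ℓ¹.
  have hstep : ∀ k, ∑ y, |d k y| ≤ r * ∑ x, |d (k + 1) x| := by
    intro k
    calc ∑ y, |d k y| ≤ ∑ y, ∑ x, |d (k + 1) x| * (A x y - ε) := by
          refine Finset.sum_le_sum fun y _ => ?_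
          have : d k y = ∑ x, d (k + 1) x * (A x y - ε) := by
            simp_rw [mul_sub]
            rw [Finset.sum_sub_distrib, ← Finset.sum_mul, hsum, ← hrec]
            simp
          rw [this]
          refine (Finset.abs_sum_le_sum_abs _ _).trans_eq (Finset.sum_congr rfl fun x _ => ?_)
          rw [abs_mul, abs_of_nonneg (sub_nonneg.2 (hA x y))]
      _ = r * ∑ x, |d (k + 1) x| := by
          rw [Finset.sum_comm]
          simp_rw [← Finset.mul_sum, hrow']
          rw [← Finset.sum_mul, mul_comm]
  have hpow : ∀ k, ∑ y, |d 0 y| ≤ r ^ k * ∑ x, |d k x| := by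
    intro k
    induction k with
    | zero => simp
    | succ k ih =>
      refine ih.trans ?_
      rw [pow_succ, mul_assoc]
      exact mul_le_mul_of_nonneg_left (hstep k) (pow_nonneg hr0 k)
  have hle : ∑ y, |d 0 y| ≤ 0 := by
    have hlim : Filter.Tendsto (fun k : ℕ => r ^ k * C) Filter.atTop (nhds 0) := by
      simpa using (tendsto_pow_atTop_nhds_zero_of_lt_one hr0 hr1).mul_const C
    exact ge_of_tendsto' hlim fun k =>
      (hpow k).trans (mul_le_mul_of_nonneg_left (hbd k) (pow_nonneg hr0 k))
  have h0 : |d 0 x| ≤ 0 :=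
    (Finset.single_le_sum (f := fun y => |d 0 y|) (fun y _ => abs_nonneg _)
      (Finset.mem_univ x)).trans hle
  exact abs_nonpos_iff.1 h0

/-- Irreducibility and aperiodicity imply primitivity. -/
lemma exists_forall_forall_of_aperiodic [Finite E] {R : ℕ → E → E → Prop}
    (hzero : ∀ x, R 0 x x) (htrans : ∀ m n x y z, R m x y → R n y z → R (m + n) x z)
    (hirr : ∀ x y, ∃ n, R n x y) (haper : ∀ x d, (∀ n, 1 ≤ n → R n x x → d ∣ n) → d = 1) :
    ∃ N, ∀ x y, R N x y := by
  have hret : ∀ x, ∃ N, ∀ m ≥ N, R m x x := by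
    intro x
    set s : Set ℕ := {n | 1 ≤ n ∧ R n x x} with hs
    have h1 : Nat.setGcd s = 1 :=
      haper x _ fun n hn hR => Nat.setGcd_dvd_of_mem ⟨hn, hR⟩
    obtain ⟨N, hN⟩ := Nat.exists_mem_closure_of_ge s
    refine ⟨N, fun m hm => ?_⟩
    have hmem := hN m hm (h1 ▸ one_dvd m)
    clear hm
    induction hmem using AddSubmonoid.closure_induction with
    | mem n hn => exact hn.2
    | zero => exact hzero x
    | add a b _ _ iha ihb => exact htrans a b x x x iha ihb
  choose N hN using hret
  choose l hl using hirr
  obtain ⟨B, hB⟩ := (Set.finite_range fun p : E × E => N p.1 + l p.1 p.2).bddAbove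
  -- Return to x after `B - l x y` steps, which is at least `N x`, then go to y in `l x y` steps.
  refine ⟨B, fun x y => ?_⟩
  have hxy : N x + l x y ≤ B := hB ⟨(x, y), rfl⟩
  have := htrans (B - l x y) (l x y) x x y (hN x _ (by omega)) (hl x y)
  rwa [Nat.sub_add_cancel (by omega)] at this

open scoped Pointwise

variable [Finite E] [MeasurableSpace E] [DiscreteMeasurableSpace E] [MeasurableSpace G]
  {f : E → G → E} {β : Measure G}

lemma exists_mem_closure_apply_eq (hf : Measurable (Function.uncurry f))
    (hirr : Kernel.IsIrreducible Measure.count (transitionKernel f β)) (x y : E) :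
    ∃ k ∈ Submonoid.closure (stepSupport f β), k x = y := by
  obtain ⟨n, hn⟩ := hirr.irreducible (measurableSet_singleton y) (by simp) x
  obtain ⟨g, hg, hgx⟩ := (transitionKernel_pow_pos_iff hf n x {y}).1 hn
  exact ⟨g, mem_closure_of_mem_pow hg, hgx⟩

lemma exists_transitionKernel_pow_pos (hf : Measurable (Function.uncurry f))
    (hirr : Kernel.IsIrreducible Measure.count (transitionKernel f β))
    (haper : Aperiodic (transitionKernel f β)) :
    ∃ N : ℕ, ∀ x y, 0 < (transitionKernel f β ^ N) x {y} := by
  refine exists_forall_forall_of_aperiodic (R := fun n x y => 0 < (transitionKernel f β ^ n) x {y})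
    ?_ ?_ (fun x y => hirr.irreducible (measurableSet_singleton y) (by simp) x) haper
  · intro x
    exact (transitionKernel_pow_pos_iff hf 0 x {x}).2 ⟨1, by simp, rfl⟩
  · intro m n x y z hxy hyz
    obtain ⟨g, hg, hgx⟩ := (transitionKernel_pow_pos_iff hf m x {y}).1 hxy
    obtain ⟨h, hh, hhy⟩ := (transitionKernel_pow_pos_iff hf n y {z}).1 hyz
    refine (transitionKernel_pow_pos_iff hf _ x {z}).2 ⟨h * g, ?_, ?_⟩
    · rw [add_comm, pow_add]; exact Set.mul_mem_mul hh hg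
    · change h (g x) = z
      rw [show g x = y from hgx]; exact hhy

lemma isMarkovKernel_transitionKernel [IsProbabilityMeasure β]
    (hf : Measurable (Function.uncurry f)) : IsMarkovKernel (transitionKernel f β) :=
  ⟨fun _ => Measure.isProbabilityMeasure_map (hf.comp measurable_prodMk_left).aemeasurable⟩

lemma isMarkovKernel_pow {α : Type*} [MeasurableSpace α] (κ : Kernel α α) [IsMarkovKernel κ]
    (n : ℕ) : IsMarkovKernel (κ ^ n) := by
  induction n with
  | zero => exact inferInstanceAs (IsMarkovKernel Kernel.id)
  | succ n ih =>
    rw [pow_succ]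
    exact inferInstanceAs (IsMarkovKernel ((κ ^ n) ∘ₖ κ))

lemma comp_pow_of_comp_eq {α : Type*} [MeasurableSpace α] {κ : Kernel α α}
    {μ : ℤ → Measure α} (hμ : ∀ n, μ (n + 1) = κ ∘ₘ μ n) (n : ℤ) (N : ℕ) :
    μ (n + N) = (κ ^ N) ∘ₘ μ n := by
  induction N with
  | zero =>
    rw [pow_zero, Nat.cast_zero, add_zero]
    exact Measure.id_comp.symm
  | succ N ih =>
    rw [Nat.cast_succ, ← add_assoc, hμ, ih, pow_succ', Measure.comp_assoc]
    rfl

lemma real_comp_singleton [Fintype E] (κ : Kernel E E) [IsMarkovKernel κ] (μ : Measure E)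
    [IsFiniteMeasure μ] (y : E) :
    (κ ∘ₘ μ).real {y} = ∑ x, μ.real {x} * (κ x).real {y} := by
  rw [Measure.real, Measure.bind_apply MeasurableSet.of_discrete κ.aemeasurable,
    lintegral_fintype, ENNReal.toReal_sum fun x _ =>
      ENNReal.mul_ne_top (measure_ne_top _ _) (measure_ne_top _ _)]
  refine Finset.sum_congr rfl fun x _ => ?_
  rw [ENNReal.toReal_mul, mul_comm]
  rfl

/-- A chain indexed by `ℤ` with a primitive kernel is stationary. -/
theorem law_succ_eq_of_pow_pos [Nonempty E] {κ : Kernel E E} [IsMarkovKernel κ]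
    {μ : ℤ → Measure E} [∀ n, IsProbabilityMeasure (μ n)] (hμ : ∀ n, μ (n + 1) = κ ∘ₘ μ n)
    {N : ℕ} (hN : ∀ x y, 0 < (κ ^ N) x {y}) (n : ℤ) : μ (n + 1) = μ n := by
  cases nonempty_fintype E
  have := isMarkovKernel_pow κ N
  have hpos : ∀ x y, 0 < ((κ ^ N) x).real {y} := fun x y =>
    ENNReal.toReal_pos (hN x y).ne' (measure_ne_top _ _)
  obtain ⟨p, hp⟩ := Finite.exists_min (fun p : E × E => ((κ ^ N) p.1).real {p.2})
  have hprob : ∀ (ν : Measure E) [IsProbabilityMeasure ν], ∑ y, ν.real {y} = 1 := by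
    intro ν _
    rw [sum_measureReal_singleton]
    simp
  have hrec : ∀ (m : ℤ) (y : E),
      (μ (m + N)).real {y} = ∑ x, (μ m).real {x} * ((κ ^ N) x).real {y} := by
    intro m y
    rw [comp_pow_of_comp_eq hμ, real_comp_singleton]
  -- Difference of consecutive laws, followed into the past in strides of N; its ℓ¹ norm is at most
  -- 2.
  set d : ℕ → E → ℝ := fun k y =>
    (μ (n + 1 - k * N)).real {y} - (μ (n - k * N)).real {y} with hd
  have hzero : ∀ y, d 0 y = 0 := by
    refine eq_zero_of_backward_orbit (A := fun x y => ((κ ^ N) x).real {y}) (C := 2)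
      (hpos p.1 p.2) (fun x y => hp (x, y)) (fun x => hprob _) ?_ ?_ ?_
    · intro k y
      simp only [hd, sub_mul, Finset.sum_sub_distrib]
      rw [← hrec, ← hrec]
      congr 4 <;> push_cast <;> ring
    · intro k
      simp only [hd, Finset.sum_sub_distrib, hprob, sub_self]
    · intro k
      calc ∑ x, |d k x| ≤ ∑ x, ((μ (n + 1 - k * N)).real {x} + (μ (n - k * N)).real {x}) := by
            refine Finset.sum_le_sum fun x _ => (abs_sub _ _).trans_eq ?_
            rw [abs_of_nonneg measureReal_nonneg, abs_of_nonneg measureReal_nonneg]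
        _ = 2 := by rw [Finset.sum_add_distrib, hprob, hprob]; norm_num
  refine Measure.ext_of_singleton fun y => ?_
  have h := hzero y
  simp only [hd, Nat.cast_zero, zero_mul, sub_zero] at h
  rw [← measureReal_eq_measureReal_iff]
  linarith

end Stationarity

/-! ### Independence of a state from later innovations -/

section Independence

lemma isPiSystem_image2_inter {α : Type*} (b c : MeasurableSpace α) :
    IsPiSystem (Set.image2 (· ∩ ·) {s | MeasurableSet[b] s} {t | MeasurableSet[c] t}) := by
  rintro _ ⟨s, hs, t, ht, rfl⟩ _ ⟨s', hs', t', ht', rfl⟩ -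
  exact ⟨s ∩ s', MeasurableSet.inter hs hs', t ∩ t', MeasurableSet.inter ht ht',
    Set.inter_inter_inter_comm s s' t t'⟩

lemma generateFrom_image2_inter {α : Type*} (b c : MeasurableSpace α) :
    b ⊔ c = MeasurableSpace.generateFrom
      (Set.image2 (· ∩ ·) {s | MeasurableSet[b] s} {t | MeasurableSet[c] t}) := by
  refine le_antisymm (sup_le ?_ ?_) (MeasurableSpace.generateFrom_le ?_)
  · intro s hs
    exact MeasurableSpace.measurableSet_generateFrom
      ⟨s, hs, Set.univ, MeasurableSet.univ, Set.inter_univ s⟩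
  · intro t ht
    exact MeasurableSpace.measurableSet_generateFrom
      ⟨Set.univ, MeasurableSet.univ, t, ht, Set.univ_inter t⟩
  · rintro _ ⟨s, hs, t, ht, rfl⟩
    exact MeasurableSet.inter ((le_sup_left : b ≤ b ⊔ c) s hs) ((le_sup_right : c ≤ b ⊔ c) t ht)

/-- On the generating π-system of intersections, P(r ∩ s ∩ t) = P(r ∩ s) P(t) = P(r) P(s) P(t) =
P(r) P(s ∩ t). -/
lemma indep_sup_right_of_indep_sup {mΩ : MeasurableSpace Ω} {P : Measure Ω}
    [IsProbabilityMeasure P] {a b c : MeasurableSpace Ω} (ha : a ≤ mΩ) (hb : b ≤ mΩ) (hc : c ≤ mΩ)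
    (hab : Indep a b P) (hcab : Indep c (a ⊔ b) P) : Indep a (b ⊔ c) P := by
  refine IndepSets.indep ha (sup_le hb hc) (@MeasurableSpace.isPiSystem_measurableSet Ω a)
    (isPiSystem_image2_inter b c) (@MeasurableSpace.generateFrom_measurableSet Ω a).symm
    (generateFrom_image2_inter b c) ?_
  rw [IndepSets_iff]
  rintro r _ hr ⟨s, hs, t, ht, rfl⟩
  have hle_a : a ≤ a ⊔ b := le_sup_left
  have hle_b : b ≤ a ⊔ b := le_sup_right
  have hab' := (Indep_iff a b P).1 hab
  have hcab' := (Indep_iff c (a ⊔ b) P).1 hcab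
  change P (r ∩ (s ∩ t)) = P r * P (s ∩ t)
  rw [← Set.inter_assoc, Set.inter_comm (r ∩ s), hcab' t (r ∩ s) ht
    (MeasurableSet.inter (hle_a r hr) (hle_b s hs)), hab' r s hr hs, Set.inter_comm s t,
    hcab' t s ht (hle_b s hs)]
  ring

lemma comap_cylinderEvents [MeasurableSpace G] (V : ℤ → Ω → G) (Δ : Set ℤ) :
    (cylinderEvents Δ).comap (fun ω n => V n ω)
      = ⨆ k ∈ Δ, MeasurableSpace.comap (V k) inferInstance := by
  simp only [cylinderEvents, MeasurableSpace.comap_iSup, MeasurableSpace.comap_comp]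
  rfl

variable [MeasurableSpace E] [MeasurableSpace G] [mΩ : MeasurableSpace Ω]
  {P : Measure Ω} {f : E → G → E} {β : Measure G} {X : ℤ → Ω → E} {V : ℤ → Ω → G}

lemma IsGoverned.isProbabilityMeasure [IsProbabilityMeasure P] (h : IsGoverned P f β X V) :
    IsProbabilityMeasure β :=
  h.law 0 ▸ Measure.isProbabilityMeasure_map (h.measurable_V 0).aemeasurable

lemma IsGoverned.indepFun_succ (h : IsGoverned P f β X V) (n : ℤ) :
    IndepFun (X n) (V (n + 1)) P := by
  have hm : Measurable fun z : Set.Iic n → E × G => (z ⟨n, Set.mem_Iic.2 le_rfl⟩).1 := by fun_prop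
  exact ((h.indep_past n).comp measurable_id hm).symm

/-- The state at time `j` is independent of all later innovations. -/
lemma IsGoverned.indep_future [IsProbabilityMeasure P] (h : IsGoverned P f β X V) (j : ℤ) :
    Indep (MeasurableSpace.comap (X j) inferInstance)
      ((cylinderEvents (Set.Ioi j)).comap fun ω n => V n ω) P := by
  set m : ℕ → MeasurableSpace Ω := fun n =>
    ⨆ i < n, MeasurableSpace.comap (V (j + i + 1)) inferInstance with hm
  have hVle : ∀ k, MeasurableSpace.comap (V k) inferInstance ≤ mΩ := fun k =>
    (h.measurable_V k).comap_le
  have hXle : MeasurableSpace.comap (X j) inferInstance ≤ mΩ := (h.measurable_X j).comap_le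
  have hmle : ∀ n, m n ≤ mΩ := fun n => iSup₂_le fun i _ => hVle _
  have hind : ∀ n, Indep (MeasurableSpace.comap (X j) inferInstance) (m n) P := by
    intro n
    induction n with
    | zero => simpa [hm] using indep_bot_right _
    | succ n ih =>
      have hsucc : m (n + 1) = m n ⊔ MeasurableSpace.comap (V (j + n + 1)) inferInstance :=
        Nat.iSup_lt_succ _ n
      rw [hsucc]
      refine indep_sup_right_of_indep_sup hXle (hmle n) (hVle _) ih ?_
      -- The past up to time j + n contains both `X j` and the innovations collected in `m n`.
      refine indep_of_indep_of_le_right (h.indep_past (j + n)) (sup_le ?_ (iSup₂_le ?_))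
      · have he : Measurable fun z : Set.Iic (j + (n : ℤ)) → E × G =>
            (z ⟨j, Set.mem_Iic.2 (by omega)⟩).1 := by fun_prop
        have : X j = (fun z : Set.Iic (j + (n : ℤ)) → E × G =>
            (z ⟨j, Set.mem_Iic.2 (by omega)⟩).1) ∘ fun ω k => (X k ω, V k ω) := rfl
        rw [this, ← MeasurableSpace.comap_comp]
        exact MeasurableSpace.comap_mono he.comap_le
      · intro i hi
        have he : Measurable fun z : Set.Iic (j + (n : ℤ)) → E × G =>
            (z ⟨j + i + 1, Set.mem_Iic.2 (by omega)⟩).2 := by fun_prop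
        have : V (j + i + 1) = (fun z : Set.Iic (j + (n : ℤ)) → E × G =>
            (z ⟨j + i + 1, Set.mem_Iic.2 (by omega)⟩).2) ∘ fun ω k => (X k ω, V k ω) := rfl
        rw [this, ← MeasurableSpace.comap_comp]
        exact MeasurableSpace.comap_mono he.comap_le
  have hmono : Monotone m := fun a b hab =>
    biSup_mono fun i hi => lt_of_lt_of_le hi hab
  have hsup : Indep (⨆ n, m n) (MeasurableSpace.comap (X j) inferInstance) P :=
    indep_iSup_of_monotone (fun n => (hind n).symm) hmle hXle hmono
  refine (indep_of_indep_of_le_left hsup ?_).symm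
  rw [comap_cylinderEvents]
  refine iSup₂_le fun k hk => ?_
  obtain ⟨i, hi⟩ : ∃ i : ℕ, k = j + i + 1 := ⟨(k - j - 1).toNat, by
    have := Set.mem_Ioi.1 hk; omega⟩
  subst hi
  exact (le_iSup₂_of_le (f := fun (i' : ℕ) (_ : i' < i + 1) =>
    MeasurableSpace.comap (V (j + i' + 1)) inferInstance) i (Nat.lt_succ_self i) le_rfl).trans
    (le_iSup m (i + 1))

lemma IsGoverned.map_succ [IsProbabilityMeasure P] (h : IsGoverned P f β X V) (hf : Measurable (Function.uncurry f))
    (n : ℤ) : P.map (X (n + 1)) = ((P.map (X n)).prod β).map (Function.uncurry f) := by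
  have hX := h.measurable_X n
  have hV := h.measurable_V (n + 1)
  have hprod := (indepFun_iff_map_prod_eq_prod_map_map hX.aemeasurable hV.aemeasurable).1
    (h.indepFun_succ n)
  rw [← h.law (n + 1), ← hprod, Measure.map_map hf (hX.prodMk hV)]
  exact Measure.map_congr (h.recursion n)

end Independence

/-! ### Image of the stationary law under minimal-rank maps -/

section Law

variable [MeasurableSpace E] [DiscreteMeasurableSpace E] [MeasurableSpace G]
  [MeasurableSpace Ω] {P : Measure Ω} [IsProbabilityMeasure P] {f : E → G → E} {β : Measure G}
  {X : ℤ → Ω → E} {V : ℤ → Ω → G}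

lemma IsGoverned.lintegral_map_preimage (h : IsGoverned P f β X V)
    (hf : Measurable (Function.uncurry f)) (n : ℤ) (A : Set E) :
    ∫⁻ v, P.map (X n) (step f v ⁻¹' A) ∂β = P.map (X (n + 1)) A := by
  have := h.isProbabilityMeasure
  have := Measure.isProbabilityMeasure_map (μ := P) (h.measurable_X n).aemeasurable
  have hA : MeasurableSet A := MeasurableSet.of_discrete
  rw [h.map_succ hf, Measure.map_apply hf hA, Measure.prod_apply_symm (hf hA)]
  rfl

variable [Finite E]

lemma IsGoverned.map_succ_eq_comp (h : IsGoverned P f β X V)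
    (hf : Measurable (Function.uncurry f)) (n : ℤ) :
    P.map (X (n + 1)) = transitionKernel f β ∘ₘ P.map (X n) := by
  have := h.isProbabilityMeasure
  ext A hA
  rw [h.map_succ hf, Measure.map_apply hf hA, Measure.prod_apply (hf hA),
    Measure.bind_apply hA (Kernel.aemeasurable _)]
  refine lintegral_congr fun x => ?_
  exact (Measure.map_apply (hf.comp measurable_prodMk_left) hA).symm

/-- The image of the law of the chain under a map of minimal rank is uniform. -/
theorem IsGoverned.map_preimage_eq_uniformOn [Nonempty E] (h : IsGoverned P f β X V)
    (hf : Measurable (Function.uncurry f))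
    (hirr : Kernel.IsIrreducible Measure.count (transitionKernel f β))
    (haper : Aperiodic (transitionKernel f β)) (n : ℤ) {g : Function.End E}
    (hg : IsMinimalRank (Submonoid.closure (stepSupport f β)) g)
    (B : Set E) : P.map (X n) (g ⁻¹' B) = uniformOn (Set.range g) B := by
  have := h.isProbabilityMeasure
  have hprob : ∀ k, IsProbabilityMeasure (P.map (X k)) := fun k =>
    Measure.isProbabilityMeasure_map (h.measurable_X k).aemeasurable
  have := isMarkovKernel_transitionKernel (β := β) hf
  obtain ⟨N, hN⟩ := exists_transitionKernel_pow_pos hf hirr haper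
  have hst : P.map (X (n + 1)) = P.map (X n) :=
    law_succ_eq_of_pow_pos (μ := fun k => P.map (X k)) (h.map_succ_eq_comp hf) hN n
  have hfib : ∀ y ∈ Set.range g, P.map (X n) (g ⁻¹' {y}) = (rank g : ENNReal)⁻¹ := fun y hy =>
    measure_fiber_of_isMinimalRank hf
      (fun A => (h.lintegral_map_preimage hf n A).trans (by rw [hst]))
      (exists_mem_closure_apply_eq hf hirr) hg hy
  have hmap : ∀ A : Set E, (P.map (X n)).map (g : E → E) A = P.map (X n) (g ⁻¹' A) := fun A =>
    Measure.map_apply Measurable.of_discrete MeasurableSet.of_discrete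
  suffices heq : (P.map (X n)).map (g : E → E) = uniformOn (Set.range g) by
    exact (hmap B).symm.trans (congrArg (fun μ : Measure E => μ B) heq)
  refine Measure.ext_of_singleton fun y => (hmap {y}).trans ?_
  rw [uniformOn,
    cond_apply MeasurableSet.of_discrete, Measure.count_apply MeasurableSet.of_discrete,
    Measure.count_apply MeasurableSet.of_discrete]
  by_cases hy : y ∈ Set.range g
  · rw [hfib y hy, Set.inter_eq_right.2 (Set.singleton_subset_iff.2 hy), rank,
      Set.encard_singleton, ← Set.Finite.cast_ncard_eq (Set.toFinite (Set.range g)),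
      ENat.toENNReal_coe, ENat.toENNReal_one, mul_one]
  · have h1 : g ⁻¹' {y} = ∅ :=
      Set.eq_empty_of_forall_notMem fun z hz => hy ⟨z, hz⟩
    have h2 : Set.range g ∩ {y} = ∅ := Set.inter_singleton_eq_empty.2 hy
    rw [h1, h2]
    simp

end Law

/-! ### The products `T_n` and the set `R₀` -/

section Products

/-- `T_n` as an element of the monoid of self-maps of `E`. -/
def endT (f : E → G → E) (v : ℤ → G) (n : ℕ) : Function.End E := T f v n

lemma endT_zero (f : E → G → E) (v : ℤ → G) : endT f v 0 = 1 := rfl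

lemma endT_succ (f : E → G → E) (v : ℤ → G) (n : ℕ) :
    endT f v (n + 1) = endT f v n * step f (v (-(n : ℤ))) := rfl

lemma R₀_eq_iInter (f : E → G → E) (v : ℤ → G) : R₀ f v = ⋂ n, Set.range (endT f v n) := rfl

lemma endT_mem_closure {f : E → G → E} {v : ℤ → G} {S : Set (Function.End E)}
    (hv : ∀ k, step f (v k) ∈ S) (n : ℕ) : endT f v n ∈ Submonoid.closure S := by
  induction n with
  | zero => exact Submonoid.one_mem _
  | succ n ih => exact Submonoid.mul_mem _ ih (Submonoid.subset_closure (hv _))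

lemma antitone_range_endT (f : E → G → E) (v : ℤ → G) :
    Antitone fun n => Set.range (endT f v n) := by
  refine antitone_nat_of_succ_le fun n => ?_
  change Set.range (endT f v n * step f (v (-(n : ℤ)))) ⊆ _
  rw [range_mul]
  exact Set.image_subset_range _ _

/-- The ranges decrease with n and cannot shrink below the minimal rank. -/
lemma R₀_eq_range_endT [Finite E] {f : E → G → E} {v : ℤ → G} {S : Set (Function.End E)}
    (hv : ∀ k, step f (v k) ∈ S) {N : ℕ}
    (hN : IsMinimalRank (Submonoid.closure S) (endT f v N)) :
    R₀ f v = Set.range (endT f v N) := by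
  rw [R₀_eq_iInter]
  refine Set.Subset.antisymm (Set.iInter_subset _ N) (Set.subset_iInter fun n => ?_)
  rcases le_total n N with h | h
  · exact antitone_range_endT f v h
  · exact (Set.eq_of_subset_of_ncard_le (antitone_range_endT f v h)
      (hN.2 _ (endT_mem_closure hv n))).ge

lemma isMinimalRank_endT_of_le [Finite E] {f : E → G → E} {v : ℤ → G} {S : Set (Function.End E)}
    (hv : ∀ k, step f (v k) ∈ S) {N : ℕ}
    (hN : IsMinimalRank (Submonoid.closure S) (endT f v N)) {n : ℕ} (hn : N ≤ n) :
    IsMinimalRank (Submonoid.closure S) (endT f v n) :=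
  ⟨endT_mem_closure hv n, fun h hh =>
    (Set.ncard_le_ncard (antitone_range_endT f v hn)).trans (hN.2 h hh)⟩

variable [Finite E] [MeasurableSpace E] [DiscreteMeasurableSpace E] [MeasurableSpace G]
  {f : E → G → E}

/-- `T_n` involves only times after -n, the very innovations of which `X_{-n}` is independent. -/
lemma measurable_endT_cylinderEvents (hf : Measurable (Function.uncurry f)) (n : ℕ) :
    Measurable[cylinderEvents (Set.Ioi (-(n : ℤ)))] fun v : ℤ → G => endT f v n := by
  induction n with
  | zero => exact @measurable_const _ _ _ (cylinderEvents _) _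
  | succ n ih =>
    have h1 : Measurable[cylinderEvents (Set.Ioi (-((n + 1 : ℕ) : ℤ)))]
        fun v : ℤ → G => endT f v n :=
      ih.mono (cylinderEvents_mono (Set.Ioi_subset_Ioi (by push_cast; omega))) le_rfl
    have h2 : Measurable[cylinderEvents (Set.Ioi (-((n + 1 : ℕ) : ℤ)))]
        fun v : ℤ → G => step f (v (-(n : ℤ))) :=
      (measurable_step hf).comp
        (measurable_cylinderEvent_apply (Set.mem_Ioi.2 (by push_cast; omega)))
    exact (Measurable.of_discrete
      (f := fun p : Function.End E × Function.End E => p.1 * p.2)).comp (h1.prodMk h2)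

lemma measurable_endT (hf : Measurable (Function.uncurry f)) (n : ℕ) :
    Measurable fun v : ℤ → G => endT f v n :=
  (measurable_endT_cylinderEvents hf n).mono cylinderEvents_le_pi le_rfl

lemma measurable_R₀ (hf : Measurable (Function.uncurry f)) :
    Measurable fun v : ℤ → G => R₀ f v := by
  rw [measurable_set_iff]
  intro x
  simp only [R₀_eq_iInter, Set.mem_iInter]
  refine Measurable.forall fun n => ?_
  exact (Measurable.of_discrete (f := fun g : Function.End E => x ∈ Set.range g)).comp
    (measurable_endT hf n)

/-- The kernel that sends `v` to the uniform law on `R₀ f v`. -/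
def uniformKernel (hf : Measurable (Function.uncurry f)) : Kernel (ℤ → G) E where
  toFun v := uniformOn (R₀ f v)
  measurable' := (Measurable.of_discrete (f := fun s : Set E => (uniformOn s : Measure E))).comp
    (measurable_R₀ hf)

instance (hf : Measurable (Function.uncurry f)) : IsFiniteKernel (uniformKernel hf) :=
  ⟨1, ENNReal.one_lt_top, fun v => prob_le_one (μ := uniformOn (R₀ f v))⟩

end Products

/-! ### Almost sure attainment of minimal rank -/

section MinimalRank

open scoped Pointwise

variable [MeasurableSpace E] [MeasurableSpace G] [MeasurableSpace Ω] {P : Measure Ω}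
  {f : E → G → E} {β : Measure G} {X : ℤ → Ω → E} {V : ℤ → Ω → G}

lemma IsGoverned.measurable_innovations (h : IsGoverned P f β X V) :
    Measurable fun ω n => V n ω := measurable_pi_lambda _ h.measurable_V

lemma IsGoverned.ae_eq_endT_apply (h : IsGoverned P f β X V) (n : ℕ) :
    ∀ᵐ ω ∂P, X 0 ω = endT f (fun k => V k ω) n (X (-(n : ℤ)) ω) := by
  induction n with
  | zero => exact Filter.Eventually.of_forall fun ω => rfl
  | succ n ih =>
    filter_upwards [ih, h.recursion (-((n + 1 : ℕ) : ℤ))] with ω h1 h2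
    have he : -((n + 1 : ℕ) : ℤ) + 1 = -(n : ℤ) := by push_cast; ring
    rw [he] at h2
    rw [h1, h2]
    rfl

variable [Finite E]

lemma IsGoverned.ae_step_mem (h : IsGoverned P f β X V) :
    ∀ᵐ ω ∂P, ∀ k, step f (V k ω) ∈ stepSupport f β := by
  refine ae_all_iff.2 fun k => ?_
  have := ae_step_mem_stepSupport f β
  rw [← h.law k] at this
  have := ae_of_ae_map (h.measurable_V k).aemeasurable this
  rwa [h.law k] at this

variable [DiscreteMeasurableSpace E]

lemma IsGoverned.indepFun_endT_step (h : IsGoverned P f β X V)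
    (hf : Measurable (Function.uncurry f)) (n : ℕ) :
    IndepFun (fun ω => endT f (fun k => V k ω) n) (fun ω => step f (V (-(n : ℤ)) ω)) P := by
  have hdisj : Disjoint (Set.Ioi (-(n : ℤ))) {-(n : ℤ)} := by simp
  have hind := indep_iSup_of_disjoint (fun k => (h.measurable_V k).comap_le) h.indep.iIndep hdisj
  rw [← comap_cylinderEvents] at hind
  refine indep_of_indep_of_le hind ?_ ?_
  · have : (fun ω => endT f (fun k => V k ω) n)
        = (fun v : ℤ → G => endT f v n) ∘ fun ω k => V k ω := rfl
    rw [this, ← MeasurableSpace.comap_comp]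
    exact MeasurableSpace.comap_mono (measurable_endT_cylinderEvents hf n).comap_le
  · have : (fun ω => step f (V (-(n : ℤ)) ω)) = step f ∘ V (-(n : ℤ)) := rfl
    rw [this, ← MeasurableSpace.comap_comp]
    refine (MeasurableSpace.comap_mono (measurable_step hf).comap_le).trans ?_
    exact le_iSup₂_of_le (-(n : ℤ)) rfl le_rfl

variable [IsProbabilityMeasure P]

lemma IsGoverned.map_endT_succ (h : IsGoverned P f β X V) (hf : Measurable (Function.uncurry f))
    (n : ℕ) : P.map (fun ω => endT f (fun k => V k ω) (n + 1))
      = (P.map fun ω => endT f (fun k => V k ω) n) ∗ₘ β.map (step f) := by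
  have hT : Measurable fun ω => endT f (fun k => V k ω) n :=
    (measurable_endT hf n).comp h.measurable_innovations
  have hS : Measurable fun ω => step f (V (-(n : ℤ)) ω) :=
    (measurable_step hf).comp (h.measurable_V _)
  have hlaw : P.map (fun ω => step f (V (-(n : ℤ)) ω)) = β.map (step f) := by
    rw [← h.law (-(n : ℤ)), Measure.map_map (measurable_step hf) (h.measurable_V _)]
    rfl
  have := (h.indepFun_endT_step hf n).map_mul_eq_map_mconv_map hT hS
  rw [hlaw] at this
  exact this

/-- An identity of laws only: the second block of `T_{m+n}` is built from older innovations than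
`T_n`, but has the same law. -/
lemma IsGoverned.map_endT_add (h : IsGoverned P f β X V) (hf : Measurable (Function.uncurry f))
    (m n : ℕ) : P.map (fun ω => endT f (fun k => V k ω) (m + n))
      = (P.map fun ω => endT f (fun k => V k ω) m)
        ∗ₘ (P.map fun ω => endT f (fun k => V k ω) n) := by
  induction n with
  | zero =>
    simp only [endT_zero, Measure.map_const, measure_univ, one_smul, add_zero,
      Measure.mconv_dirac_one]
  | succ n ih =>
    have := h.isProbabilityMeasure
    rw [← add_assoc, h.map_endT_succ hf, ih, h.map_endT_succ hf, Measure.mconv_assoc]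

lemma mconv_singleton_mul_ne_zero {M : Type*} [Monoid M] [MeasurableSpace M]
    [DiscreteMeasurableSpace M] [MeasurableMul₂ M] {μ ν : Measure M} [SFinite ν] {a b : M}
    (ha : μ {a} ≠ 0) (hb : ν {b} ≠ 0) : (μ ∗ₘ ν) {a * b} ≠ 0 := by
  rw [Measure.mconv, Measure.map_apply measurable_mul MeasurableSet.of_discrete]
  intro h0
  have hsub : ({a} : Set M) ×ˢ ({b} : Set M) ⊆ (fun p : M × M => p.1 * p.2) ⁻¹' {a * b} := by
    rintro ⟨x, y⟩ ⟨hx, hy⟩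
    simp only [Set.mem_singleton_iff] at hx hy
    simp [hx, hy]
  have := measure_mono_null hsub h0
  rw [Measure.prod_prod] at this
  exact (mul_ne_zero ha hb) this

lemma mconv_apply_le_mul {M : Type*} [Monoid M] [MeasurableSpace M]
    [DiscreteMeasurableSpace M] [MeasurableMul₂ M] {μ ν : Measure M} [SFinite ν] {s : Set M}
    (hs : ∀ a b, a * b ∈ s → a ∈ s ∧ b ∈ s) : (μ ∗ₘ ν) s ≤ μ s * ν s := by
  rw [Measure.mconv, Measure.map_apply measurable_mul MeasurableSet.of_discrete,
    ← Measure.prod_prod]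
  exact measure_mono fun p hp => hs p.1 p.2 hp

lemma IsGoverned.map_endT_singleton_ne_zero (h : IsGoverned P f β X V)
    (hf : Measurable (Function.uncurry f)) {n : ℕ} {g : Function.End E}
    (hg : g ∈ stepSupport f β ^ n) : (P.map fun ω => endT f (fun k => V k ω) n) {g} ≠ 0 := by
  have := h.isProbabilityMeasure
  induction n generalizing g with
  | zero =>
    rw [pow_zero, Set.mem_one] at hg
    simp [endT_zero, hg]
  | succ n ih =>
    rw [pow_succ] at hg
    obtain ⟨a, ha, b, hb, rfl⟩ := Set.mem_mul.1 hg
    rw [h.map_endT_succ hf]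
    refine mconv_singleton_mul_ne_zero (ih ha) ?_
    rw [Measure.map_apply (measurable_step hf) MeasurableSet.of_discrete]
    exact hb

/-- Almost surely, `T_n` has minimal rank for some `n`. -/
theorem IsGoverned.ae_exists_isMinimalRank (h : IsGoverned P f β X V)
    (hf : Measurable (Function.uncurry f)) :
    ∀ᵐ ω ∂P, ∃ N, IsMinimalRank (Submonoid.closure (stepSupport f β))
      (endT f (fun k => V k ω) N) := by
  obtain ⟨g, hg⟩ := exists_isMinimalRank (Submonoid.closure (stepSupport f β))
  obtain ⟨l, hl⟩ := exists_mem_pow_of_mem_closure hg.1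
  have hTmeas : ∀ n, Measurable fun ω => endT f (fun k => V k ω) n := fun n =>
    (measurable_endT hf n).comp h.measurable_innovations
  set ν : ℕ → Measure (Function.End E) := fun n => P.map fun ω => endT f (fun k => V k ω) n with hν
  have hνprob : ∀ n, IsProbabilityMeasure (ν n) := fun n =>
    Measure.isProbabilityMeasure_map (hTmeas n).aemeasurable
  -- A bad product has only bad factors, so `T_{kl}` is bad with probability at most the k-th power
  -- of that for `T_l`; the latter is below 1 because `T_l` hits g with positive probability.
  set bad : Set (Function.End E) := {k | rank g < rank k} with hbad
  have hbad_mul : ∀ a b, a * b ∈ bad → a ∈ bad ∧ b ∈ bad := fun a b hab =>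
    ⟨lt_of_lt_of_le hab (rank_mul_le_left a b), lt_of_lt_of_le hab (rank_mul_le_right a b)⟩
  have hlt : ν l bad < 1 := by
    refine lt_of_le_of_ne prob_le_one fun h1 => ?_
    have h0 : ν l badᶜ = 0 := (prob_compl_eq_zero_iff MeasurableSet.of_discrete).2 h1
    exact h.map_endT_singleton_ne_zero hf hl
      (measure_mono_null (Set.singleton_subset_iff.2 (lt_irrefl (rank g))) h0)
  have hpow : ∀ k : ℕ, ν (k * l) bad ≤ ν l bad ^ k := by
    intro k
    induction k with
    | zero => simpa using prob_le_one
    | succ k ih =>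
      have hadd : ν ((k + 1) * l) = ν (k * l) ∗ₘ ν l := by
        rw [Nat.succ_mul]; exact h.map_endT_add hf (k * l) l
      rw [hadd, pow_succ]
      exact (mconv_apply_le_mul hbad_mul).trans (mul_le_mul_left ih _)
  have hnull : P {ω | ∀ n, endT f (fun k => V k ω) n ∈ bad} = 0 := by
    refine le_antisymm (ge_of_tendsto' (ENNReal.tendsto_pow_atTop_nhds_zero_of_lt_one hlt)
      fun k => le_trans ?_ (hpow k)) zero_le
    rw [hν, Measure.map_apply (hTmeas _) MeasurableSet.of_discrete]
    exact measure_mono fun ω hω => hω _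
  filter_upwards [h.ae_step_mem, measure_eq_zero_iff_ae_notMem.1 hnull] with ω hω hω'
  obtain ⟨N, hN⟩ := not_forall.1 hω'
  exact ⟨N, endT_mem_closure hω N, fun k hk => (not_lt.1 hN).trans (hg.2 k hk)⟩

end MinimalRank

/-! ### Conditional law of `X_0` given the innovations -/

section ConditionalLaw

variable [Finite E] [MeasurableSpace E] [DiscreteMeasurableSpace E] [MeasurableSpace G]
  [MeasurableSpace Ω] {P : Measure Ω} [IsProbabilityMeasure P] {f : E → G → E} {β : Measure G}
  {X : ℤ → Ω → E} {V : ℤ → Ω → G}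

/-- The joint law of `X₀` and the innovations, in terms of the law of the chain at time `-n`. -/
lemma IsGoverned.measure_inter_eq_lintegral (h : IsGoverned P f β X V)
    (hf : Measurable (Function.uncurry f)) (n : ℕ) {A : Set (ℤ → G)}
    (hA : MeasurableSet[cylinderEvents (Set.Ioi (-(n : ℤ)))] A) (B : Set E) :
    P ((fun ω k => V k ω) ⁻¹' A ∩ X 0 ⁻¹' B)
      = ∫⁻ ω in (fun ω k => V k ω) ⁻¹' A,
          P.map (X (-(n : ℤ))) (endT f (fun k => V k ω) n ⁻¹' B) ∂P := by
  set 𝒱 : Ω → ℤ → G := fun ω k => V k ω with h𝒱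
  have h𝒱meas : Measurable 𝒱 := h.measurable_innovations
  have hAmeas : MeasurableSet (𝒱 ⁻¹' A) := h𝒱meas (cylinderEvents_le_pi A hA)
  -- Recording only `T_n` and membership in A keeps the values in a finite discrete space, where
  -- every set is measurable.
  set F : (ℤ → G) → Function.End E × Prop := fun v => (endT f v n, v ∈ A) with hF
  have hFmeas : Measurable[cylinderEvents (Set.Ioi (-(n : ℤ)))] F :=
    (measurable_endT_cylinderEvents hf n).prodMk
      ((@measurable_mem _ A (cylinderEvents (Set.Ioi (-(n : ℤ))))).2 hA)
  have hWmeas : Measurable (F ∘ 𝒱) := (hFmeas.mono cylinderEvents_le_pi le_rfl).comp h𝒱meas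
  have hXmeas := h.measurable_X (-(n : ℤ))
  have hind : IndepFun (X (-(n : ℤ))) (F ∘ 𝒱) P := by
    refine indep_of_indep_of_le_right (h.indep_future (-(n : ℤ))) ?_
    rw [← MeasurableSpace.comap_comp]
    exact MeasurableSpace.comap_mono hFmeas.comap_le
  have hprod := (indepFun_iff_map_prod_eq_prod_map_map hXmeas.aemeasurable
    hWmeas.aemeasurable).1 hind
  set D : Set (E × Function.End E × Prop) := {p | p.2.1 p.1 ∈ B ∧ p.2.2} with hD
  have hprobX : IsProbabilityMeasure (P.map (X (-(n : ℤ)))) :=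
    Measure.isProbabilityMeasure_map hXmeas.aemeasurable
  have hprobW : IsProbabilityMeasure (P.map (F ∘ 𝒱)) :=
    Measure.isProbabilityMeasure_map hWmeas.aemeasurable
  calc P (𝒱 ⁻¹' A ∩ X 0 ⁻¹' B)
      = P ((fun ω => (X (-(n : ℤ)) ω, (F ∘ 𝒱) ω)) ⁻¹' D) := by
        refine measure_congr ?_
        filter_upwards [h.ae_eq_endT_apply n] with ω hω
        refine propext ?_
        change (𝒱 ω ∈ A ∧ X 0 ω ∈ B) ↔ (endT f (𝒱 ω) n (X (-(n : ℤ)) ω) ∈ B ∧ 𝒱 ω ∈ A)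
        rw [hω, and_comm]
    _ = ((P.map (X (-(n : ℤ)))).prod (P.map (F ∘ 𝒱))) D := by
        rw [← hprod, Measure.map_apply (hXmeas.prodMk hWmeas) MeasurableSet.of_discrete]
    _ = ∫⁻ ω, P.map (X (-(n : ℤ))) ((fun x => (x, F (𝒱 ω))) ⁻¹' D) ∂P := by
        rw [Measure.prod_apply_symm MeasurableSet.of_discrete,
          lintegral_map Measurable.of_discrete hWmeas]
        rfl
    _ = ∫⁻ ω in 𝒱 ⁻¹' A, P.map (X (-(n : ℤ))) (endT f (𝒱 ω) n ⁻¹' B) ∂P := by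
        rw [← lintegral_indicator hAmeas]
        refine lintegral_congr fun ω => ?_
        by_cases hω : 𝒱 ω ∈ A
        · rw [Set.indicator_of_mem (show ω ∈ 𝒱 ⁻¹' A from hω)]
          congr 1
          ext x
          exact and_iff_left hω
        · rw [Set.indicator_of_notMem (show ω ∉ 𝒱 ⁻¹' A from hω)]
          refine measure_mono_null (fun x hx => ?_) measure_empty
          exact absurd hx.2 hω

lemma exists_measurableSet_cylinderEvents_Ioi {A : Set (ℤ → G)}
    (hA : A ∈ measurableCylinders fun _ : ℤ => G) :
    ∃ n₀ : ℕ, ∀ n ≥ n₀, MeasurableSet[cylinderEvents (Set.Ioi (-(n : ℤ)))] A := by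
  obtain ⟨s, S, hS, rfl⟩ := (mem_measurableCylinders A).1 hA
  obtain ⟨b, hb⟩ := s.bddBelow
  -- Then -n < b, so all coordinates of the cylinder lie strictly after -n.
  refine ⟨(1 - b).toNat, fun n hn => ?_⟩
  have hrestrict : Measurable[cylinderEvents (Set.Ioi (-(n : ℤ)))]
      fun v : ℤ → G => s.restrict v := by
    refine @measurable_pi_lambda _ _ _ (cylinderEvents _) _ _ fun k => ?_
    refine measurable_cylinderEvent_apply (Set.mem_Ioi.2 ?_)
    have := hb k.2
    omega
  exact hrestrict hS

/-- The joint law of the innovations and `X₀` disintegrates along the uniform laws on `R₀`. -/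
theorem IsGoverned.map_prodMk_eq_compProd [Nonempty E] (h : IsGoverned P f β X V)
    (hf : Measurable (Function.uncurry f))
    (hirr : Kernel.IsIrreducible Measure.count (transitionKernel f β))
    (haper : Aperiodic (transitionKernel f β)) :
    P.map (fun ω => ((fun k => V k ω), X 0 ω))
      = P.map (fun ω k => V k ω) ⊗ₘ uniformKernel hf := by
  set 𝒱 : Ω → ℤ → G := fun ω k => V k ω with h𝒱
  have h𝒱meas : Measurable 𝒱 := h.measurable_innovations
  have hX := h.measurable_X 0
  have hprob : IsProbabilityMeasure (P.map 𝒱) :=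
    Measure.isProbabilityMeasure_map h𝒱meas.aemeasurable
  have hcyl : ∀ (B : Set E), ∀ A ∈ measurableCylinders fun _ : ℤ => G,
      P (𝒱 ⁻¹' A ∩ X 0 ⁻¹' B) = ∫⁻ ω in 𝒱 ⁻¹' A, uniformOn (R₀ f (𝒱 ω)) B ∂P := by
    intro B A hA
    obtain ⟨n₀, hn₀⟩ := exists_measurableSet_cylinderEvents_Ioi hA
    have hlim : Filter.Tendsto (fun n : ℕ => ∫⁻ ω in 𝒱 ⁻¹' A,
        P.map (X (-(n : ℤ))) (endT f (𝒱 ω) n ⁻¹' B) ∂P) Filter.atTop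
        (nhds (∫⁻ ω in 𝒱 ⁻¹' A, uniformOn (R₀ f (𝒱 ω)) B ∂P)) := by
      refine tendsto_lintegral_of_dominated_convergence (fun _ => 1) (fun n => ?_) (fun n => ?_)
        ?_ ?_
      · exact (Measurable.of_discrete
          (f := fun g : Function.End E => P.map (X (-(n : ℤ))) (g ⁻¹' B))).comp
          ((measurable_endT hf n).comp h𝒱meas)
      · have := Measure.isProbabilityMeasure_map (μ := P) (h.measurable_X (-(n : ℤ))).aemeasurable
        exact Filter.Eventually.of_forall fun ω => prob_le_one
      · simp
      · refine ae_restrict_of_ae ?_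
        filter_upwards [h.ae_step_mem, h.ae_exists_isMinimalRank hf] with ω hω hN
        obtain ⟨N, hN⟩ := hN
        -- For almost every ω the integrand no longer depends on n once `T_n` has minimal rank.
        refine tendsto_const_nhds.congr' ?_
        filter_upwards [Filter.eventually_ge_atTop N] with n hn
        have hmin := isMinimalRank_endT_of_le hω hN hn
        rw [h.map_preimage_eq_uniformOn hf hirr haper _ hmin, R₀_eq_range_endT hω hmin]
    -- The integrals all equal the left-hand side as soon as the cylinder A lies after time -n.
    refine tendsto_nhds_unique (tendsto_const_nhds.congr' ?_) hlim
    filter_upwards [Filter.eventually_ge_atTop n₀] with n hn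
    exact h.measure_inter_eq_lintegral hf n (hn₀ n hn) B
  have hprob' := Measure.isProbabilityMeasure_map (μ := P) (h𝒱meas.prodMk hX).aemeasurable
  refine Measure.ext_prod fun {A B} hA hB => ?_
  have hker : Measurable fun v => uniformKernel hf v B := Kernel.measurable_coe _ hB
  -- With B fixed, both sides are finite measures in A, so agreement on the π-system of cylinders
  -- suffices.
  have hmeas_eq : (P.restrict (X 0 ⁻¹' B)).map 𝒱
      = (P.map 𝒱).withDensity fun v => uniformKernel hf v B := by
    have hkey : ∀ C ∈ measurableCylinders fun _ : ℤ => G, (P.restrict (X 0 ⁻¹' B)).map 𝒱 C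
        = (P.map 𝒱).withDensity (fun v => uniformKernel hf v B) C := by
      intro C hC
      have hCm := MeasurableSet.of_mem_measurableCylinders hC
      rw [Measure.map_apply h𝒱meas hCm, Measure.restrict_apply (h𝒱meas hCm), hcyl B C hC,
        withDensity_apply _ hCm, setLIntegral_map hCm hker h𝒱meas]
      rfl
    exact ext_of_generate_finite _ generateFrom_measurableCylinders.symm
      isPiSystem_measurableCylinders hkey (hkey _ (univ_mem_measurableCylinders _))
  rw [Measure.compProd_apply_prod hA hB, ← withDensity_apply _ hA, ← hmeas_eq,
    Measure.map_apply h𝒱meas hA, Measure.restrict_apply (h𝒱meas hA),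
    Measure.map_apply (h𝒱meas.prodMk hX) (hA.prod hB)]
  rfl

end ConditionalLaw

end ConstructiveChain

end

theorem mainTheorem2 {E G Ω : Type*} [Finite E] [Nonempty E] [MeasurableSpace E]
    [DiscreteMeasurableSpace E] [MeasurableSpace G] [MeasurableSpace Ω]
    (P : Measure Ω) [IsProbabilityMeasure P]
    (f : E → G → E) (hf : Measurable (Function.uncurry f)) (β : Measure G)
    (X : ℤ → Ω → E) (V : ℤ → Ω → G)
    (hXV : ConstructiveChain.IsGoverned P f β X V)
    (hirr : Kernel.IsIrreducible Measure.count (ConstructiveChain.transitionKernel f β))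
    (haper : ConstructiveChain.Aperiodic (ConstructiveChain.transitionKernel f β)) :
    (∀ᵐ ω ∂P, condDistrib (X 0) (fun ω' (n : ℤ) => V n ω') P (fun n => V n ω)
        = uniformOn (ConstructiveChain.R₀ f (fun n => V n ω))) ∧
    (∀ᵐ ω ∂P,
      ConstructiveChain.PairwiseNonAccordable f β
        (ConstructiveChain.R₀ f (fun n => V n ω)) ∧
      (ConstructiveChain.R₀ f (fun n => V n ω)).ncard
        = ConstructiveChain.maxNonAccordable f β) := by
  have := hXV.isProbabilityMeasure
  constructor
  · exact ae_of_ae_map hXV.measurable_innovations.aemeasurable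
      (condDistrib_ae_eq_of_measure_eq_compProd_of_measurable hXV.measurable_innovations
        (hXV.measurable_X 0) (hXV.map_prodMk_eq_compProd hf hirr haper))
  · filter_upwards [hXV.ae_step_mem, hXV.ae_exists_isMinimalRank hf] with ω hω hN
    obtain ⟨N, hN⟩ := hN
    rw [ConstructiveChain.R₀_eq_range_endT hω hN]
    exact ⟨ConstructiveChain.pairwiseNonAccordable_range hf hN,
      ConstructiveChain.rank_eq_maxNonAccordable hf hN⟩
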